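/- For a group homomorphism $f\colon A\to B$, a group $K$ is called $f$-local if $f^*\colon \mathrm{Hom}(B,K)\to \mathrm{Hom}(A,K)$ is a bijection, and the $f$-localization $G\to L_fG$ of a group $G$ is the initial homomorphism from $G$ to an $f$-local group. A radical is a functor $R$ that assigns to every group $G$ a normal subgroup $RG$ such that every homomorphism $G\to K$ restricts to $RG\to RK$, and such that $R(G/RG)=1$. If $f$ is an epimorphism, $R_f$ denotes the radical associated to the localization class of $f$, that is, the radical for which $G\to G/R_fG$ is the $f$-localization of $G$ for every group $G$. For a group $G$, let $\Gamma G$ denote the maximal $G$-perfect normal subgroup of $G$, where a normal subgroup $H$ of $G$ is $G$-perfect if $H=[H,G]$. **Proposition 3.1.** Let $\psi\colon X\to Y$ be an integral homology equivalence of topological spaces, i.e. a continuous map inducing isomorphisms $H_n(X;\mathbb Z)\to H_n(Y;\mathbb Z)$ on singular homology for all $n\ge 0$. Let $x_0\in X$ be such that the induced homomorphism $f=\pi_1\psi\colon \pi_1(X,x_0)\to\pi_1(Y,\psi(x_0))$ is an epimorphism. Then $R_fG\subset \Gamma G$ for all groups $G$. -/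

import Mathlib

universe u v w w'

/-! ### Integral homology equivalences -/

/-- The map induced by `ψ` on the `n`-th singular homology group with integral coefficients. -/
noncomputable def integralHomologyMap {X Y : Type u} [TopologicalSpace X] [TopologicalSpace Y]
    (ψ : C(X, Y)) (n : ℕ) :=
  ((AlgebraicTopology.singularHomologyFunctor (ModuleCat.{u} ℤ) n).obj
    (ModuleCat.of ℤ (ULift.{u} ℤ))).map (TopCat.ofHom ψ)

/-- `ψ` is an integral homology equivalence: it induces isomorphisms on all singular homology
groups with integral coefficients. -/
def IsIntegralHomologyEquiv {X Y : Type u} [TopologicalSpace X] [TopologicalSpace Y]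
    (ψ : C(X, Y)) : Prop :=
  ∀ n : ℕ, CategoryTheory.IsIso (integralHomologyMap ψ n)

/-! ### The maximal relatively perfect subgroup `Γ G` -/

/-- A subgroup `H` of `G` is `G`-perfect if it is normal and `H = [H, G]`. -/
def IsRelPerfect {G : Type w} [Group G] (H : Subgroup G) : Prop :=
  H.Normal ∧ ⁅H, (⊤ : Subgroup G)⁆ = H

/-- `Γ G`, the subgroup generated by all `G`-perfect normal subgroups of `G`. By
`isGreatest_relPerfectCore` it is the maximal `G`-perfect normal subgroup. -/
def relPerfectCore (G : Type w) [Group G] : Subgroup G :=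
  sSup {H : Subgroup G | IsRelPerfect H}

theorem isGreatest_relPerfectCore (G : Type w) [Group G] :
    IsGreatest {H : Subgroup G | IsRelPerfect H} (relPerfectCore G) := by
  have hn : (relPerfectCore G).Normal := by
    unfold relPerfectCore
    refine ⟨fun x hx g => ?_⟩
    have h : sSup {H : Subgroup G | IsRelPerfect H} ≤
        (sSup {H : Subgroup G | IsRelPerfect H}).comap (MulAut.conj g).toMonoidHom := by
      refine sSup_le fun H hH y hy => ?_
      exact (le_sSup hH : H ≤ _) (hH.1.conj_mem y hy g)
    exact h hx
  refine ⟨⟨hn, le_antisymm (Subgroup.commutator_le_left _ _) ?_⟩, fun H hH => le_sSup hH⟩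
  refine sSup_le fun H hH => ?_
  calc H = ⁅H, (⊤ : Subgroup G)⁆ := hH.2.symm
    _ ≤ _ := Subgroup.commutator_mono (le_sSup hH) le_rfl

/-! ### Localization of groups with respect to a homomorphism -/

/-- A group `G` is `f`-local if `f^* : Hom(B, G) → Hom(A, G)` is a bijection. -/
def IsLocalGroup {A : Type u} {B : Type v} [Group A] [Group B] (f : A →* B)
    (G : Type w) [Group G] : Prop :=
  Function.Bijective (fun φ : B →* G => φ.comp f)

/-- `l : G → L` is the `f`-localization of `G`: it is initial among the homomorphisms from `G`
into `f`-local groups. -/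
structure IsGroupLocalization {A : Type u} {B : Type v} [Group A] [Group B] (f : A →* B)
    {G L : Type w} [Group G] [Group L] (l : G →* L) : Prop where
  isLocal : IsLocalGroup f L
  initial : ∀ (K : Type w) [Group K], IsLocalGroup f K →
    ∀ φ : G →* K, ∃! φ' : L →* K, φ'.comp l = φ

/-- A radical on the category of groups. -/
structure GroupRadical where
  sub : ∀ (G : Type w) [Group G], Subgroup G
  normal : ∀ (G : Type w) [Group G], (sub G).Normal
  map_le : ∀ (G K : Type w) [Group G] [Group K] (φ : G →* K), (sub G).map φ ≤ sub K
  quotient_eq_bot : ∀ (G : Type w) [Group G], sub (G ⧸ sub G) = ⊥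

/-- For an epimorphism `f`, a group is `f`-local iff all homomorphisms from the source of `f` into
it kill `ker f`. -/
theorem isLocalGroup_iff_of_surjective {A : Type u} {B : Type v} [Group A] [Group B] {f : A →* B}
    (hf : Function.Surjective f) (G : Type w) [Group G] :
    IsLocalGroup f G ↔ ∀ φ : A →* G, f.ker ≤ φ.ker := by
  constructor
  · intro h φ a ha
    obtain ⟨χ, rfl⟩ := h.2 φ
    rw [MonoidHom.mem_ker] at ha
    simp [MonoidHom.mem_ker, ha]
  · intro h
    refine ⟨fun φ χ hφ => (MonoidHom.cancel_right hf).1 hφ, fun φ => ?_⟩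
    exact ⟨f.liftOfSurjective hf ⟨φ, h φ⟩, MonoidHom.ext fun a =>
      f.liftOfRightInverse_comp_apply _ (Function.rightInverse_surjInv hf) ⟨φ, h φ⟩ a⟩

/-- The intersection of all normal subgroups of `G` with `f`-local quotient. -/
def localQuotientKernel {A : Type u} {B : Type v} [Group A] [Group B] (f : A →* B)
    (G : Type w) [Group G] : Subgroup G where
  carrier := {g | ∀ (N : Subgroup G) [N.Normal], IsLocalGroup f (G ⧸ N) → g ∈ N}
  one_mem' N _ _ := N.one_mem
  mul_mem' ha hb N _ hN := N.mul_mem (ha N hN) (hb N hN)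
  inv_mem' ha N _ hN := N.inv_mem (ha N hN)

instance localQuotientKernel_normal {A : Type u} {B : Type v} [Group A] [Group B] (f : A →* B)
    (G : Type w) [Group G] : (localQuotientKernel f G).Normal :=
  ⟨fun a ha g N hn hN => hn.conj_mem a (ha N hN) g⟩

theorem localQuotientKernel_le_ker {A : Type u} {B : Type v} [Group A] [Group B] {f : A →* B}
    (hf : Function.Surjective f) {G : Type w} {K : Type w'} [Group G] [Group K]
    (hK : IsLocalGroup f K) (φ : G →* K) : localQuotientKernel f G ≤ φ.ker := by
  intro g hg
  refine hg φ.ker ?_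
  rw [isLocalGroup_iff_of_surjective hf] at hK ⊢
  intro χ a ha
  have h := hK ((QuotientGroup.kerLift φ).comp χ) ha
  rw [MonoidHom.mem_ker, MonoidHom.comp_apply] at h
  rw [MonoidHom.mem_ker]
  exact QuotientGroup.kerLift_injective φ (by rw [h, map_one])

theorem isLocalGroup_quotient {A : Type u} {B : Type v} [Group A] [Group B] {f : A →* B}
    (hf : Function.Surjective f) (G : Type w) [Group G] :
    IsLocalGroup f (G ⧸ localQuotientKernel f G) := by
  rw [isLocalGroup_iff_of_surjective hf]
  intro χ a ha
  obtain ⟨g, hg⟩ := QuotientGroup.mk'_surjective (localQuotientKernel f G) (χ a)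
  rw [MonoidHom.mem_ker, ← hg, QuotientGroup.mk'_apply, QuotientGroup.eq_one_iff]
  intro N hn hN
  have hle : localQuotientKernel f G ≤ N := fun x hx => hx N hN
  let p : G ⧸ localQuotientKernel f G →* G ⧸ N :=
    QuotientGroup.map _ N (MonoidHom.id G) hle
  have h := (isLocalGroup_iff_of_surjective hf _).1 hN (p.comp χ) ha
  rw [MonoidHom.mem_ker, MonoidHom.comp_apply, ← hg] at h
  exact (QuotientGroup.eq_one_iff g).1 h

/-- The radical `R_f` associated to the localization class of an epimorphism `f`. By
`isGroupLocalization_radical` and `IsGroupLocalization.ker_eq_radical` it is the one for which `G → G ⧸ R_f G` is the `f`-localization of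
every group `G`. -/
def localizationRadical {A : Type u} {B : Type v} [Group A] [Group B] (f : A →* B)
    (hf : Function.Surjective f) : GroupRadical.{w} where
  sub G _ := localQuotientKernel f G
  normal G _ := localQuotientKernel_normal f G
  map_le G K _ _ φ := by
    rw [Subgroup.map_le_iff_le_comap]
    have h := localQuotientKernel_le_ker hf (isLocalGroup_quotient hf K)
      ((QuotientGroup.mk' (localQuotientKernel f K)).comp φ)
    rwa [← MonoidHom.comap_ker, QuotientGroup.ker_mk'] at h
  quotient_eq_bot G _ := by
    have h := localQuotientKernel_le_ker hf (isLocalGroup_quotient hf G)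
      (MonoidHom.id (G ⧸ localQuotientKernel f G))
    rw [eq_bot_iff]
    exact fun x hx => h hx

instance localizationRadical_normal {A : Type u} {B : Type v} [Group A] [Group B] (f : A →* B)
    (hf : Function.Surjective f) (G : Type w) [Group G] :
    ((localizationRadical f hf).sub G).Normal :=
  (localizationRadical f hf).normal G

theorem isGroupLocalization_radical {A : Type u} {B : Type v} [Group A] [Group B] (f : A →* B)
    (hf : Function.Surjective f) (G : Type w) [Group G] :
    IsGroupLocalization f (QuotientGroup.mk' ((localizationRadical f hf).sub G)) where
  isLocal := isLocalGroup_quotient hf G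
  initial K _ hK φ := by
    refine ⟨QuotientGroup.lift _ φ (localQuotientKernel_le_ker hf hK φ), ?_, fun χ hχ => ?_⟩
    · ext g
      rfl
    · ext g
      exact DFunLike.congr_fun hχ g

/-- `R_f G` is the kernel of every `f`-localization of `G`, so `R_f` is determined by
`L_f G ≅ G ⧸ R_f G`. -/
theorem IsGroupLocalization.ker_eq_radical {A : Type u} {B : Type v} [Group A] [Group B]
    {f : A →* B} (hf : Function.Surjective f) {G L : Type w} [Group G] [Group L] {l : G →* L}
    (hl : IsGroupLocalization f l) : l.ker = (localizationRadical f hf).sub G := by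
  refine le_antisymm (fun g hg => ?_) (localQuotientKernel_le_ker hf hl.isLocal l)
  obtain ⟨φ, hφ, -⟩ := hl.initial _ (isLocalGroup_quotient hf G) (QuotientGroup.mk' _)
  have h := DFunLike.congr_fun hφ g
  rw [MonoidHom.comp_apply, MonoidHom.mem_ker.1 hg, map_one] at h
  exact (QuotientGroup.eq_one_iff g).1 h.symm

/-! Since `f` is onto, a group is `f`-local when every homomorphism from the source of `f` kills
`f.ker`. It therefore suffices that `G ⧸ Γ G` is `f`-local. This holds once `f.ker = ⁅f.ker, ⊤⁆`:
the normal closure of any image of `f.ker` is then relatively perfect, while `Γ (G ⧸ Γ G)` is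
trivial.

The topological input is `IsIntegralHomologyEquiv.ker_map_le_commutator`, a cochain version of
Stallings' argument. For `N = ⁅f.ker, ⊤⁆`, the quotient `E` of `π₁ X` by `N` is a central extension
of `π₁ Y`. Its group 2-cocycle yields a singular 2-cocycle `a` on `Y` whose pull-back to `X` is the
coboundary of a cochain `c`, and `c` detects whether a loop in `f.ker` is trivial in `E`. The image
of such a loop bounds a singular simplex on which `a` vanishes. Injectivity on `H₁` and surjectivity
on `H₂` transfer this vanishing to `c`, so the loop lies in `N`. As `X` and `Y` need not be path
connected, injectivity on `H₀` is used to extend the algebraic data over whole fundamental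
groupoids. -/

/-! ### Relatively perfect subgroups and the radical -/

/-- The preimage of a relatively perfect `H` is again relatively perfect: its commutator with `G`
maps onto `H` and contains `N = ⁅N, ⊤⁆`. Maximality of `N` then forces `H` to be trivial. -/
theorem relPerfectCore_quotient_eq_bot (G : Type w) [Group G] (N : Subgroup G) [N.Normal]
    (hN : N = relPerfectCore G) : relPerfectCore (G ⧸ N) = ⊥ := by
  have hG := isGreatest_relPerfectCore G
  rw [← hN] at hG
  refine (sSup_eq_bot.2 fun H hH => ?_)
  have hle : N ≤ H.comap (QuotientGroup.mk' N) := fun x hx => by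
    rw [Subgroup.mem_comap, QuotientGroup.mk'_apply, (QuotientGroup.eq_one_iff x).2 hx]
    exact H.one_mem
  have hnorm : (H.comap (QuotientGroup.mk' N)).Normal := hH.1.comap _
  have hperf : IsRelPerfect (H.comap (QuotientGroup.mk' N)) := by
    refine ⟨hnorm, le_antisymm (Subgroup.commutator_le_left _ _) ?_⟩
    have hNc : N ≤ ⁅H.comap (QuotientGroup.mk' N), (⊤ : Subgroup G)⁆ := by
      conv_lhs => rw [← hG.1.2]
      exact Subgroup.commutator_mono hle le_rfl
    have hmap : (⁅H.comap (QuotientGroup.mk' N), (⊤ : Subgroup G)⁆).map (QuotientGroup.mk' N) =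
        H := by
      rw [Subgroup.map_commutator,
        Subgroup.map_comap_eq_self_of_surjective (QuotientGroup.mk'_surjective N),
        Subgroup.map_top_of_surjective _ (QuotientGroup.mk'_surjective N), hH.2]
    conv_lhs => rw [← hmap]
    rw [Subgroup.comap_map_eq, QuotientGroup.ker_mk']
    exact sup_le le_rfl hNc
  rw [eq_bot_iff]
  intro q hq
  obtain ⟨g, rfl⟩ := QuotientGroup.mk'_surjective N q
  exact (QuotientGroup.eq_one_iff g).2 (hG.2 hperf hq)

/-- The image need not be normal in `K`, but its normal closure is relatively perfect: the
commutator of that closure with `K` is normal and already contains the image. -/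
theorem map_le_relPerfectCore {A : Type u} [Group A] {N : Subgroup A}
    (hN : N ≤ ⁅N, (⊤ : Subgroup A)⁆) {K : Type w} [Group K] (φ : A →* K) :
    N.map φ ≤ relPerfectCore K := by
  have hle : N.map φ ≤ Subgroup.normalClosure (N.map φ : Set K) := Subgroup.subset_normalClosure
  refine hle.trans (le_sSup ⟨inferInstance, le_antisymm (Subgroup.commutator_le_left _ _) ?_⟩)
  refine Subgroup.normalClosure_le_normal ?_
  calc N.map φ ≤ (⁅N, (⊤ : Subgroup A)⁆).map φ := Subgroup.map_mono hN
    _ = ⁅N.map φ, (⊤ : Subgroup A).map φ⁆ := Subgroup.map_commutator _ _ _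
    _ ≤ _ := Subgroup.commutator_mono hle le_top

theorem localizationRadical_le_relPerfectCore {A : Type u} {B : Type v} [Group A] [Group B]
    (f : A →* B) (hf : Function.Surjective f) (h : f.ker ≤ ⁅f.ker, (⊤ : Subgroup A)⁆)
    (G : Type w) [Group G] : (localizationRadical f hf).sub G ≤ relPerfectCore G := by
  have hn : (relPerfectCore G).Normal := (isGreatest_relPerfectCore G).1.1
  refine fun g hg => hg (relPerfectCore G) ((isLocalGroup_iff_of_surjective hf _).2 fun φ => ?_)
  rw [← Subgroup.map_eq_bot_iff, eq_bot_iff, ← relPerfectCore_quotient_eq_bot G _ rfl]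
  exact map_le_relPerfectCore h φ

/-! ### Central extensions and their 2-cocycles -/

theorem ker_lift_commutator_le_center {A : Type u} {B : Type v} [Group A] [Group B] (f : A →* B)
    (h : ⁅f.ker, (⊤ : Subgroup A)⁆ ≤ f.ker) :
    (QuotientGroup.lift ⁅f.ker, (⊤ : Subgroup A)⁆ f h).ker ≤ Subgroup.center _ := fun e he => by
  obtain ⟨a, rfl⟩ := QuotientGroup.mk_surjective e
  refine Subgroup.mem_center_iff.2 fun e' => ?_
  obtain ⟨b, rfl⟩ := QuotientGroup.mk_surjective e'
  refine QuotientGroup.eq.2 ?_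
  -- Equality of cosets asks for this element to lie in the subgroup; it is the commutator of `a⁻¹`
  -- and `b⁻¹`.
  have hc : (b * a)⁻¹ * (a * b) = a⁻¹ * b⁻¹ * a⁻¹⁻¹ * b⁻¹⁻¹ := by group
  rw [hc]
  exact Subgroup.commutator_mem_commutator (inv_mem (show a ∈ f.ker from he)) (Subgroup.mem_top _)

open scoped IsMulCommutative in
/-- A central extension has a normalized `2`-cocycle whose inflation is a coboundary. -/
theorem exists_cocycle_of_central {E : Type u} {B : Type v} [Group E] [Group B] (p : E →* B)
    (hp : Function.Surjective p) (hc : p.ker ≤ Subgroup.center E) :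
    ∃ (M : Type u) (_ : AddCommGroup M) (k : B → B → M) (m : E → M),
      (∀ a b c, k a b + k (a * b) c = k b c + k a (b * c)) ∧ k 1 1 = 0 ∧
      (∀ e e', m (e * e') + k (p e) (p e') = m e + m e') ∧
      (∀ e, p e = 1 → m e = 0 → e = 1) := by
  -- For a section `s`, take `k a b = s a * s b * (s (a * b))⁻¹` and `m e = s (p e) * e⁻¹`.
  -- Normalizing `s 1 = 1` gives `k 1 1 = 0` and makes `m e` equal to `e⁻¹` on `p.ker`.
  obtain ⟨s, hs, hs1⟩ : ∃ s : B → E, (∀ b, p (s b) = b) ∧ s 1 = 1 := by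
    classical
    refine ⟨fun b => if b = 1 then 1 else (hp b).choose, fun b => ?_, if_pos rfl⟩
    dsimp only
    split_ifs with h
    · rw [h, map_one]
    · exact (hp b).choose_spec
  have hk : ∀ a b, s a * s b * (s (a * b))⁻¹ ∈ Subgroup.center E := fun a b =>
    hc (by simp [MonoidHom.mem_ker, hs])
  have hm : ∀ e, s (p e) * e⁻¹ ∈ Subgroup.center E := fun e =>
    hc (by simp [MonoidHom.mem_ker, hs])
  refine ⟨Additive (Subgroup.center E), inferInstance, fun a b => Additive.ofMul ⟨_, hk a b⟩, fun e => Additive.ofMul ⟨_, hm e⟩,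
    fun a b c => ?_, ?_, fun e e' => ?_, fun e he h => ?_⟩
  · rw [← ofMul_mul, ← ofMul_mul]
    refine congrArg _ (Subtype.ext ?_)
    have h := Subgroup.mem_center_iff.1 (hk b c) (s a)
    calc s a * s b * (s (a * b))⁻¹ * (s (a * b) * s c * (s (a * b * c))⁻¹)
        = s a * (s b * s c * (s (b * c))⁻¹) * (s (b * c) * (s (a * b * c))⁻¹) := by group
      _ = s b * s c * (s (b * c))⁻¹ * (s a * s (b * c) * (s (a * (b * c)))⁻¹) := by
        rw [h, mul_assoc a b c]; group
  · exact congrArg Additive.ofMul (Subtype.ext (by simp [hs1]))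
  · rw [← ofMul_mul, ← ofMul_mul]
    refine congrArg _ (Subtype.ext ?_)
    have h' := Subgroup.mem_center_iff.1 (hm e') e⁻¹
    calc s (p (e * e')) * (e * e')⁻¹ * (s (p e) * s (p e') * (s (p e * p e'))⁻¹)
        = s (p e) * s (p e') * (s (p e * p e'))⁻¹ * (s (p (e * e')) * (e * e')⁻¹) :=
          (Subgroup.mem_center_iff.1 (hm (e * e')) _).symm
      _ = s (p e) * ((s (p e') * e'⁻¹) * e⁻¹) := by rw [map_mul]; group
      _ = s (p e) * e⁻¹ * (s (p e') * e'⁻¹) := by rw [← h', mul_assoc]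
  · have h1 : s (p e) * e⁻¹ = 1 := congrArg Subtype.val (congrArg Additive.toMul h)
    simpa [he, hs1] using h1

/-! ### Homology of chain complexes in terms of elements -/

section Homology

open CategoryTheory Limits

/-- The group of integers, as a coefficient object. -/
noncomputable abbrev integers : ModuleCat.{u} ℤ := ModuleCat.of ℤ (ULift.{u} ℤ)

theorem integers_hom_ext {M : ModuleCat.{u} ℤ} {f g : integers.{u} ⟶ M}
    (h : f (ULift.up 1) = g (ULift.up 1)) : f = g := by
  let e : ℤ →ₗ[ℤ] ULift.{u} ℤ := ULift.moduleEquiv.symm.toLinearMap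
  have he : f.hom.comp e = g.hom.comp e := LinearMap.ext_ring h
  exact ModuleCat.hom_ext (LinearMap.ext fun n => LinearMap.congr_fun he n.down)

/-- The homomorphism out of the integers that takes a given value at `1`. -/
noncomputable def fromIntegers {M : ModuleCat.{u} ℤ} (x : M) : integers.{u} ⟶ M :=
  ModuleCat.ofHom ((LinearMap.toSpanSingleton ℤ M x).comp ULift.moduleEquiv.toLinearMap)

theorem fromIntegers_one {M : ModuleCat.{u} ℤ} (x : M) :
    fromIntegers x (ULift.up 1) = x :=
  LinearMap.toSpanSingleton_apply_one ℤ M x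

variable {K L : ChainComplex (ModuleCat.{u} ℤ) ℕ}

theorem exists_cycles_of_d_eq_zero (i j : ℕ) (hj : (ComplexShape.down ℕ).next i = j)
    (x : K.X i) (hx : K.d i j x = 0) : ∃ z : K.cycles i, K.iCycles i z = x := by
  have hk : fromIntegers x ≫ K.d i j = 0 := integers_hom_ext <| by
    rw [ModuleCat.comp_apply, fromIntegers_one, hx]
    rfl
  refine ⟨K.liftCycles (fromIntegers x) j hj hk (ULift.up 1), ?_⟩
  rw [← ModuleCat.comp_apply, K.liftCycles_i, fromIntegers_one]

theorem exists_toCycles_of_homologyπ_eq_zero (i : ℕ) (z : K.cycles i)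
    (hz : K.homologyπ i z = 0) : ∃ w, K.toCycles (i + 1) i w = z := by
  have hex : (ShortComplex.mk (K.toCycles (i + 1) i) (K.homologyπ i) (by simp)).Exact :=
    ShortComplex.exact_of_g_is_cokernel _ (K.homologyIsCokernel (i + 1) i (by simp))
  exact (ShortComplex.moduleCat_exact_iff _).1 hex z hz

theorem homologyπ_toCycles_apply (i : ℕ) (w : K.X (i + 1)) :
    K.homologyπ i (K.toCycles (i + 1) i w) = 0 := by
  rw [← ModuleCat.comp_apply, K.toCycles_comp_homologyπ]
  rfl

theorem homologyπ_cyclesMap_apply (φ : K ⟶ L) (i : ℕ) (z : K.cycles i) :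
    L.homologyπ i (HomologicalComplex.cyclesMap φ i z) =
      HomologicalComplex.homologyMap φ i (K.homologyπ i z) := by
  rw [← ModuleCat.comp_apply, ← ModuleCat.comp_apply, HomologicalComplex.homologyπ_naturality]

theorem iCycles_cyclesMap_apply (φ : K ⟶ L) (i : ℕ) (z : K.cycles i) :
    L.iCycles i (HomologicalComplex.cyclesMap φ i z) = φ.f i (K.iCycles i z) := by
  rw [← ModuleCat.comp_apply, ← ModuleCat.comp_apply, HomologicalComplex.cyclesMap_i]

theorem iCycles_toCycles_apply (i : ℕ) (w : K.X (i + 1)) :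
    K.iCycles i (K.toCycles (i + 1) i w) = K.d (i + 1) i w := by
  rw [← ModuleCat.comp_apply, K.toCycles_i]

/-- Injectivity on homology, at chain level. The index `j` is free so that degree `0`, where `next 0
= 0`, is covered. -/
theorem exists_eq_d_of_homologyMap_isIso (φ : K ⟶ L) (i j : ℕ)
    (hj : (ComplexShape.down ℕ).next i = j)
    [IsIso (HomologicalComplex.homologyMap φ i)] (x : K.X i) (hx : K.d i j x = 0)
    (y : L.X (i + 1)) (hy : φ.f i x = L.d (i + 1) i y) : ∃ w, x = K.d (i + 1) i w := by
  obtain ⟨z, rfl⟩ := exists_cycles_of_d_eq_zero i j hj x hx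
  have hz : HomologicalComplex.cyclesMap φ i z = L.toCycles (i + 1) i y :=
    (ModuleCat.mono_iff_injective (L.iCycles i)).1 inferInstance
      (by rw [iCycles_cyclesMap_apply, iCycles_toCycles_apply, hy])
  have h0 : K.homologyπ i z = 0 :=
    (ModuleCat.mono_iff_injective (HomologicalComplex.homologyMap φ i)).1 inferInstance
      (by rw [← homologyπ_cyclesMap_apply, hz, homologyπ_toCycles_apply, map_zero])
  obtain ⟨w, rfl⟩ := exists_toCycles_of_homologyπ_eq_zero i z h0
  exact ⟨w, iCycles_toCycles_apply i w⟩

/-- Surjectivity on homology, at chain level. -/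
theorem exists_eq_add_d_of_homologyMap_isIso (φ : K ⟶ L) (i j : ℕ)
    (hj : (ComplexShape.down ℕ).next i = j)
    [IsIso (HomologicalComplex.homologyMap φ i)] (z : L.X i) (hz : L.d i j z = 0) :
    ∃ x, K.d i j x = 0 ∧ ∃ e, z = φ.f i x + L.d (i + 1) i e := by
  obtain ⟨z, rfl⟩ := exists_cycles_of_d_eq_zero i j hj z hz
  obtain ⟨h, hh⟩ := (ModuleCat.epi_iff_surjective (HomologicalComplex.homologyMap φ i)).1
    inferInstance (L.homologyπ i z)
  obtain ⟨x, rfl⟩ := (ModuleCat.epi_iff_surjective (K.homologyπ i)).1 inferInstance h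
  obtain ⟨e, he⟩ := exists_toCycles_of_homologyπ_eq_zero i
    (z - HomologicalComplex.cyclesMap φ i x)
    (by rw [map_sub, homologyπ_cyclesMap_apply, hh, sub_self])
  refine ⟨K.iCycles i x, ?_, e, ?_⟩
  · rw [← ModuleCat.comp_apply, K.iCycles_d]
    rfl
  · rw [← iCycles_cyclesMap_apply, ← iCycles_toCycles_apply, he, map_sub]
    abel

end Homology

/-! ### Simplicial chains and cochains -/

namespace SSet

open CategoryTheory Limits Simplicial

variable (S : SSet.{u})

/-- The complex of integral simplicial chains. -/
noncomputable abbrev integralChains : ChainComplex (ModuleCat.{u} ℤ) ℕ :=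
  S.chainComplex integers

variable {S}

/-- A simplex, as a simplicial chain. -/
noncomputable def basisChain {n : ℕ} (x : S _⦋n⦌) : S.integralChains.X n :=
  (show integers ⟶ S.integralChains.X n from S.ιChainComplex x) (ULift.up 1)

theorem integralChains_hom_ext {n : ℕ} {M : ModuleCat.{u} ℤ} {f g : S.integralChains.X n ⟶ M}
    (h : ∀ x : S _⦋n⦌, f (basisChain x) = g (basisChain x)) : f = g :=
  chainComplex_hom_ext fun x => integers_hom_ext (h x)

theorem d_basisChain {n : ℕ} (x : S _⦋n + 1⦌) :
    S.integralChains.d (n + 1) n (basisChain x) =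
      ∑ i : Fin (n + 2), (-1 : ℤ) ^ (i : ℕ) • basisChain (S.δ i x) := by
  rw [basisChain, ← ModuleCat.comp_apply, ιChainComplex_d]
  exact (LinearMap.congr_fun (ModuleCat.hom_sum _ _) _).trans (LinearMap.sum_apply _ _ _)

theorem map_basisChain {T : SSet.{u}} (f : S ⟶ T) {n : ℕ} (x : S _⦋n⦌) :
    (chainComplexMap f integers.{u}).f n (basisChain x) =
      basisChain (f.app _ x) := by
  rw [basisChain, ← ModuleCat.comp_apply, ι_chainComplexMap_f]
  rfl

/-- The evaluation of a cochain with values in an abelian group. -/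
noncomputable def evalCochain {M : Type u} [AddCommGroup M] {n : ℕ} (c : S _⦋n⦌ → M) :
    S.integralChains.X n ⟶ ModuleCat.of ℤ M :=
  Sigma.desc fun x => fromIntegers (M := ModuleCat.of ℤ M) (c x)

theorem evalCochain_basisChain {M : Type u} [AddCommGroup M] {n : ℕ} (c : S _⦋n⦌ → M)
    (x : S _⦋n⦌) : evalCochain c (basisChain x) = c x := by
  have h : S.ιChainComplex x ≫ evalCochain c = fromIntegers (M := ModuleCat.of ℤ M) (c x) :=
    Sigma.ι_desc _ _
  rw [basisChain, ← ModuleCat.comp_apply, h, fromIntegers_one]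

theorem evalCochain_d {M : Type u} [AddCommGroup M] {n : ℕ} (c : S _⦋n⦌ → M)
    (c' : S _⦋n + 1⦌ → M)
    (h : ∀ x, ∑ i : Fin (n + 2), (-1 : ℤ) ^ (i : ℕ) • c (S.δ i x) = c' x)
    (y : S.integralChains.X (n + 1)) :
    evalCochain c (S.integralChains.d (n + 1) n y) = evalCochain c' y := by
  have : S.integralChains.d (n + 1) n ≫ evalCochain c = evalCochain c' := by
    refine integralChains_hom_ext fun x => ?_
    rw [evalCochain_basisChain, ← h x, ModuleCat.comp_apply, d_basisChain, map_sum]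
    exact Finset.sum_congr rfl fun i _ => by rw [map_zsmul, evalCochain_basisChain]
  exact DFunLike.congr_fun (congrArg ModuleCat.Hom.hom this) y

theorem evalCochain_map {T : SSet.{u}} (f : S ⟶ T) {M : Type u} [AddCommGroup M] {n : ℕ}
    (c : T _⦋n⦌ → M) (y : S.integralChains.X n) :
    evalCochain c ((chainComplexMap f integers.{u}).f n y) =
      evalCochain (fun x => c (f.app _ x)) y := by
  have : (chainComplexMap f integers.{u}).f n ≫ evalCochain c =
      evalCochain (fun x => c (f.app _ x)) := by
    refine integralChains_hom_ext fun x => ?_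
    rw [evalCochain_basisChain, ModuleCat.comp_apply, map_basisChain, evalCochain_basisChain]
  exact DFunLike.congr_fun (congrArg ModuleCat.Hom.hom this) y

/-- The edge `e` makes the image of `y - x` a boundary, so `y - x` bounds in `S` by injectivity on
`H₀`, and a 0-cocycle vanishes on boundaries. -/
theorem eq_of_homologyMap_zero_isIso {T : SSet.{u}} (f : S ⟶ T)
    [IsIso (SSet.homologyMap f integers.{u} 0)]
    {M : Type u} [AddCommGroup M] (c : S _⦋0⦌ → M)
    (hc : ∀ e : S _⦋1⦌, c (S.δ 0 e) = c (S.δ 1 e)) {x y : S _⦋0⦌} (e : T _⦋1⦌)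
    (hx : T.δ 1 e = f.app _ x) (hy : T.δ 0 e = f.app _ y) : c x = c y := by
  obtain ⟨w, hw⟩ := exists_eq_d_of_homologyMap_isIso
    (chainComplexMap f integers.{u}) 0 0 (by simp)
    (basisChain y - basisChain x) (by rw [HomologicalComplex.shape _ _ _ (by simp)]; rfl)
    (basisChain e) (by
      rw [map_sub, map_basisChain, map_basisChain, d_basisChain, Fin.sum_univ_two, hx, hy]
      simp [sub_eq_add_neg])
  have h := evalCochain_d c (fun _ => 0) (fun e => by simp [Fin.sum_univ_two, hc]) w
  have h0 : evalCochain (S := S) (n := 1) (fun _ => (0 : M)) = 0 :=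
    integralChains_hom_ext fun x => by rw [evalCochain_basisChain]; rfl
  rw [← hw, h0, map_sub, evalCochain_basisChain, evalCochain_basisChain] at h
  exact (sub_eq_zero.1 h).symm

/-- If `f` is an isomorphism on `H₁` and `H₂`, a `2`-cocycle of the target whose pull-back is
the coboundary of `c` takes the value `c g` on a simplex bounding the image of the cycle `g`. -/
theorem cochain_eq_of_homologyMap_isIso {T : SSet.{u}} (f : S ⟶ T)
    [IsIso (SSet.homologyMap f integers.{u} 1)]
    [IsIso (SSet.homologyMap f integers.{u} 2)]
    {M : Type u} [AddCommGroup M] (a : T _⦋2⦌ → M) (c : S _⦋1⦌ → M)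
    (ha : ∀ x : T _⦋3⦌, a (T.δ 0 x) + a (T.δ 2 x) = a (T.δ 3 x) + a (T.δ 1 x))
    (hc : ∀ x : S _⦋2⦌, c (S.δ 1 x) + a (f.app _ x) = c (S.δ 0 x) + c (S.δ 2 x))
    (g : S _⦋1⦌) (hg : S.δ 0 g = S.δ 1 g) (D : T _⦋2⦌) (hD : T.δ 0 D = T.δ 1 D)
    (hDg : T.δ 2 D = f.app _ g) : c g = a D := by
  have hfD : (chainComplexMap f integers.{u}).f 1 (basisChain g) =
      T.integralChains.d 2 1 (basisChain D) := by
    rw [map_basisChain, d_basisChain, Fin.sum_univ_three, hD, hDg]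
    simp
  -- Injectivity on `H₁`: the image of `g` is the boundary of `D`, so `g` itself is the boundary of
  -- some `w`.
  obtain ⟨w, hw⟩ := exists_eq_d_of_homologyMap_isIso
    (chainComplexMap f integers.{u}) 1 0 (by simp) (basisChain g)
    (by rw [d_basisChain, Fin.sum_univ_two, hg]; simp) _ hfD
  have hd : T.integralChains.d 2 1
      ((chainComplexMap f integers.{u}).f 2 w - basisChain D) = 0 := by
    have := congrArg (fun q => q.hom w)
      ((chainComplexMap f integers.{u}).comm 2 1)
    rw [map_sub, ← hfD, hw, sub_eq_zero]
    exact this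
  -- Surjectivity on `H₂`: the cycle `f w - D` equals `f z + d e` with `z` a cycle.
  obtain ⟨z, hz, e, he⟩ := exists_eq_add_d_of_homologyMap_isIso
    (chainComplexMap f integers.{u}) 2 1 (by simp) _ hd
  have h3 : evalCochain a (T.integralChains.d 3 2 e) = 0 := by
    rw [evalCochain_d a (fun _ => 0) (fun x => ?_) e]
    · have h0 : evalCochain (S := T) (n := 3) (fun _ => (0 : M)) = 0 :=
        integralChains_hom_ext fun x => by rw [evalCochain_basisChain]; rfl
      rw [h0]; rfl
    · have h := ha x
      rw [Fin.sum_univ_four]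
      simp only [Fin.coe_ofNat_eq_mod]
      norm_num
      rw [← sub_eq_zero] at h
      rw [← h]; abel
  have h2 : ∀ y, evalCochain c (S.integralChains.d 2 1 y) =
      evalCochain (fun x => a (f.app _ x)) y := evalCochain_d c _ fun x => by
    have h := hc x
    rw [Fin.sum_univ_three]
    simp only [Fin.coe_ofNat_eq_mod]
    norm_num
    rw [← eq_sub_iff_add_eq'] at h
    rw [h]; abel
  -- Evaluating `a`: the term `f w` gives `c (d w) = c g`, `f z` gives `c (d z) = 0`, and `d e`
  -- gives `0`.
  have h1 := congrArg (evalCochain a) he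
  rw [map_sub, map_add, evalCochain_map, evalCochain_map, h3, ← h2, ← h2, ← hw, hz, evalCochain_basisChain, evalCochain_basisChain] at h1
  simpa [sub_eq_zero] using h1

end SSet

/-! ### Functors from a groupoid to a group -/

section GroupoidCocycle

open CategoryTheory

/-- A functor from the category `C` to the group `E`, with `E` regarded as a category with one
object. -/
structure CategoryCocycle (C : Type u) [Category.{v} C] (E : Type w) [Group E] where
  /-- The value of the functor on a morphism. -/
  toFun {x y : C} (q : x ⟶ y) : E
  toFun_comp {x y z : C} (q : x ⟶ y) (r : y ⟶ z) : toFun (q ≫ r) = toFun r * toFun q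

namespace CategoryCocycle

theorem toFun_id {C : Type u} [Category.{v} C] {E : Type w} [Group E] (F : CategoryCocycle C E)
    (x : C) : F.toFun (𝟙 x) = 1 := by
  have h := F.toFun_comp (𝟙 x) (𝟙 x)
  rwa [Category.comp_id, left_eq_mul] at h

variable {C : Type u} [Groupoid.{v} C]

theorem toFun_inv {E : Type w} [Group E] (F : CategoryCocycle C E) {x y : C} (q : x ⟶ y) :
    F.toFun (Groupoid.inv q) = (F.toFun q)⁻¹ := by
  rw [eq_inv_iff_mul_eq_one, ← F.toFun_comp, Groupoid.comp_inv, F.toFun_id]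

/-- A homomorphism from a vertex group extends to the groupoid, trivially on the other
components. -/
theorem exists_extension {E : Type w} [Group E] (x : C) (φ : End x →* E) :
    ∃ F : CategoryCocycle C E, (∀ q : End x, F.toFun q = φ q) ∧
      ∀ (y z : C) (q : y ⟶ z), IsEmpty (x ⟶ y) → F.toFun q = 1 := by
  classical
  -- Chosen morphisms from `x` turn each morphism of its component into a loop at `x`; taking the
  -- identity at `x` itself makes the extension restrict to `φ`.
  obtain ⟨c, hc⟩ : ∃ c : ∀ y : C, Nonempty (x ⟶ y) → (x ⟶ y), ∀ h, c x h = 𝟙 x :=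
    ⟨fun y h => if e : x = y then eqToHom e else h.some, fun h => by simp⟩
  refine ⟨⟨fun {y z} q => if h : Nonempty (x ⟶ y) then
      φ (c y h ≫ q ≫ Groupoid.inv (c z ⟨h.some ≫ q⟩)) else 1, fun {y z w} q r => ?_⟩,
    fun q => ?_, fun y z q h => dif_neg (not_nonempty_iff.2 h)⟩
  · by_cases h : Nonempty (x ⟶ y)
    · have h' : Nonempty (x ⟶ z) := ⟨h.some ≫ q⟩
      simp only [dif_pos h, dif_pos h']
      rw [← map_mul]
      congr 1
      simp [End.mul_def]
    · have h' : ¬ Nonempty (x ⟶ z) := fun ⟨a⟩ => h ⟨a ≫ Groupoid.inv q⟩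
      simp [dif_neg h, dif_neg h']
  · have h : Nonempty (x ⟶ x) := ⟨𝟙 x⟩
    simp only [dif_pos h, hc]
    congr 1
    simp

/-- An arbitrary extension `F` of `φ` lifts `G` only on loops at `x`. Conjugating by a function `e`
on objects corrects it elsewhere: `G a * (p (F a))⁻¹` is independent of `a : x ⟶ y`, exactly because
`p ∘ F` and `G` agree on those loops, and `e y` is a lift of it. -/
theorem exists_lift {E : Type w} {B : Type w'} [Group E] [Group B] (p : E →* B)
    (hp : Function.Surjective p) (x : C) (φ : End x →* E) (G : CategoryCocycle C B)
    (hφ : ∀ q : End x, p (φ q) = G.toFun q)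
    (hG : ∀ (y z : C) (q : y ⟶ z), IsEmpty (x ⟶ y) → G.toFun q = 1) :
    ∃ F : CategoryCocycle C E, (∀ q : End x, F.toFun q = φ q) ∧
      ∀ (y z : C) (q : y ⟶ z), p (F.toFun q) = G.toFun q := by
  obtain ⟨F, hF, hF1⟩ := exists_extension x φ
  have hFG : ∀ q : x ⟶ x, p (F.toFun q) = G.toFun q := fun q => by rw [← hφ, hF]
  have he : ∀ y : C, ∃ e : E, (∀ a : x ⟶ y, p e = G.toFun a * (p (F.toFun a))⁻¹) ∧
      (y = x ∨ IsEmpty (x ⟶ y) → e = 1) := fun y => by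
    by_cases hy : y = x
    · subst hy
      exact ⟨1, fun a => by rw [hFG, map_one, mul_inv_cancel], fun _ => rfl⟩
    · by_cases h : Nonempty (x ⟶ y)
      · obtain ⟨a⟩ := h
        obtain ⟨e, he⟩ := hp (G.toFun a * (p (F.toFun a))⁻¹)
        refine ⟨e, fun b => ?_, fun h => h.elim (absurd · hy) fun h => h.elim a⟩
        have := hFG (b ≫ Groupoid.inv a)
        rw [F.toFun_comp, G.toFun_comp, F.toFun_inv, G.toFun_inv, map_mul, map_inv] at this
        rw [he, eq_mul_inv_iff_mul_eq, mul_assoc, this, mul_inv_cancel_left]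
      · exact ⟨1, fun a => absurd ⟨a⟩ h, fun _ => rfl⟩
  choose e he he1 using he
  refine ⟨⟨fun {y z} q => e z * F.toFun q * (e y)⁻¹, fun q r => ?_⟩, fun q => ?_,
    fun y z q => ?_⟩
  · rw [F.toFun_comp]; group
  · simp only [he1 x (Or.inl rfl)]
    rw [hF]; group
  · by_cases h : Nonempty (x ⟶ y)
    · obtain ⟨a⟩ := h
      simp only [map_mul, map_inv, he y a, he z (a ≫ q), F.toFun_comp, G.toFun_comp]
      group
    · rw [not_nonempty_iff] at h
      have h' : IsEmpty (x ⟶ z) := ⟨fun a => h.false (a ≫ Groupoid.inv q)⟩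
      simp [he1 y (Or.inr h), he1 z (Or.inr h'), hF1 _ _ _ h, hG _ _ _ h]

end CategoryCocycle

end GroupoidCocycle

/-! ### Cocycles along maps from simply connected spaces -/

namespace CategoryCocycle

open CategoryTheory

variable {X : Type u} [TopologicalSpace X] {E : Type w} [Group E]
  (F : CategoryCocycle (FundamentalGroupoid X) E)

section SimplyConnected

variable {S : Type v} [TopologicalSpace S] [SimplyConnectedSpace S]

/-- The value of a cocycle on the image of the path between two points of a simply connected
space. -/
noncomputable def along (g : C(S, X)) (s t : S) : E :=
  F.toFun ((FundamentalGroupoid.map g).map (X := .mk s) (Y := .mk t)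
    (Path.Homotopic.Quotient.mk (PathConnectedSpace.somePath s t)))

/-- In a simply connected space there is only one path class between two points, so the chosen path
is immaterial. -/
theorem along_eq (g : C(S, X)) {s t : S}
    (q : FundamentalGroupoid.mk s ⟶ FundamentalGroupoid.mk t) :
    F.along g s t = F.toFun ((FundamentalGroupoid.map g).map q) :=
  congrArg (fun r => F.toFun ((FundamentalGroupoid.map g).map r))
    (Subsingleton.elim (α := Path.Homotopic.Quotient s t) _ _)

theorem along_mul_along (g : C(S, X)) (s t r : S) :
    F.along g t r * F.along g s t = F.along g s r := by
  rw [along, along, ← F.toFun_comp, ← CategoryTheory.Functor.map_comp, along_eq]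

theorem along_self (g : C(S, X)) (s : S) : F.along g s s = 1 := by
  rw [F.along_eq g (𝟙 _), CategoryTheory.Functor.map_id, F.toFun_id]

theorem along_comp {S' : Type w'} [TopologicalSpace S'] [SimplyConnectedSpace S']
    (g : C(S, X)) (h : C(S', S)) (s t : S') :
    F.along (g.comp h) s t = F.along g (h s) (h t) := by
  rw [F.along_eq g ((FundamentalGroupoid.map h).map (X := .mk s) (Y := .mk t)
    (Path.Homotopic.Quotient.mk (PathConnectedSpace.somePath s t)))]
  rfl

theorem along_const (x : X) (s t : S) : F.along (.const S x) s t = 1 :=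
  (F.along_comp (.const Unit x) (.const S ()) s t).trans (F.along_self _ _)

theorem along_comp_left {Y : Type u} [TopologicalSpace Y] {B : Type w'} [Group B]
    (G : CategoryCocycle (FundamentalGroupoid Y) B) (ψ : C(X, Y)) (p : E →* B)
    (h : ∀ (y z : FundamentalGroupoid X) (q : y ⟶ z),
      p (F.toFun q) = G.toFun ((FundamentalGroupoid.map ψ).map q)) (g : C(S, X)) (s t : S) :
    p (F.along g s t) = G.along (ψ.comp g) s t :=
  h _ _ _

end SimplyConnected

instance simplyConnectedSpace_unitInterval : SimplyConnectedSpace unitInterval :=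
  have : ContractibleSpace unitInterval := (convex_Icc (0 : ℝ) 1).contractibleSpace ⟨0, by simp⟩
  inferInstance

theorem toFun_mk {x y : X} (q : Path x y) :
    F.toFun (x := .mk x) (y := .mk y) (Path.Homotopic.Quotient.mk q) =
      F.along q.toContinuousMap 0 1 := by
  obtain ⟨g, rfl, rfl⟩ := q
  exact (F.along_eq g (s := (0 : unitInterval)) (t := 1)
    (Path.Homotopic.Quotient.mk ⟨.id _, rfl, rfl⟩)).symm

end CategoryCocycle

/-! ### Singular simplices, paths and null-homotopies -/

section SingularSimplices

open CategoryTheory Simplicial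

instance simplyConnectedSpace_toTop (n : ℕ) :
    SimplyConnectedSpace (SimplexCategory.toTop.{u}.obj ⦋n⦌) :=
  have : ContractibleSpace (stdSimplex ℝ (Fin (n + 1))) :=
    (convex_stdSimplex ℝ (Fin (n + 1))).contractibleSpace ⟨_, single_mem_stdSimplex ℝ 0⟩
  have : ContractibleSpace (ULift.{u} (stdSimplex ℝ (Fin (n + 1)))) :=
    Homeomorph.ulift.contractibleSpace
  inferInstanceAs (SimplyConnectedSpace (ULift.{u} (stdSimplex ℝ (Fin (n + 1)))))

/-- The vertices of the topological simplex. -/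
noncomputable def simplexVertex {n : ℕ} (i : Fin (n + 1)) : SimplexCategory.toTop.{u}.obj ⦋n⦌ :=
  ULift.up (stdSimplex.vertex i)

theorem toTop_map_simplexVertex {n m : ℕ} (f : ⦋n⦌ ⟶ ⦋m⦌) (i : Fin (n + 1)) :
    SimplexCategory.toTop.{u}.map f (simplexVertex i) = simplexVertex (f i) :=
  congrArg ULift.up (stdSimplex.map_vertex _ _)

/-- The singular simplex given by a continuous map. -/
noncomputable def singularSimplex {X : TopCat.{u}} {n : ℕ}
    (g : C(SimplexCategory.toTop.{u}.obj ⦋n⦌, X)) : (TopCat.toSSet.obj X) _⦋n⦌ :=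
  ⟨TopCat.ofHom g⟩

/-- The continuous map underlying a singular simplex. -/
noncomputable def singularMap {X : TopCat.{u}} {n : ℕ} (σ : (TopCat.toSSet.obj X) _⦋n⦌) :
    C(SimplexCategory.toTop.{u}.obj ⦋n⦌, X) :=
  TopCat.Hom.hom σ.down

/-- The coordinates of a point of the topological simplex. -/
def simplexCoord {n : ℕ} (i : Fin (n + 1)) : C(SimplexCategory.toTop.{u}.obj ⦋n⦌, ℝ) where
  toFun t := t.down.1 i
  continuous_toFun := by
    have h : Continuous (ULift.down : SimplexCategory.toTop.{u}.obj ⦋n⦌ → _) :=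
      continuous_uliftDown
    exact (continuous_apply i).comp (continuous_subtype_val.comp h)

theorem simplexCoord_nonneg {n : ℕ} (i : Fin (n + 1)) (t : SimplexCategory.toTop.{u}.obj ⦋n⦌) :
    0 ≤ simplexCoord i t :=
  t.down.2.1 i

theorem sum_simplexCoord {n : ℕ} (t : SimplexCategory.toTop.{u}.obj ⦋n⦌) :
    ∑ i, simplexCoord i t = 1 :=
  t.down.2.2

theorem simplexCoord_vertex {n : ℕ} (i j : Fin (n + 1)) :
    simplexCoord i (simplexVertex.{u} j) = if i = j then 1 else 0 := by
  simp [simplexCoord, simplexVertex, stdSimplex.vertex, Pi.single_apply]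

theorem simplexCoord_δ_self {n : ℕ} (i : Fin (n + 2)) (t : SimplexCategory.toTop.{u}.obj ⦋n⦌) :
    simplexCoord i (SimplexCategory.toTop.{u}.map (SimplexCategory.δ i) t) = 0 := by
  refine (FunOnFinite.linearMap_apply_apply ℝ ℝ _ t.down.1 i).trans (Finset.sum_eq_zero ?_)
  intro j hj
  exact absurd (Finset.mem_filter.1 hj).2 (Fin.succAbove_ne i j)

theorem simplexCoord_δ_succAbove {n : ℕ} (i : Fin (n + 2)) (j : Fin (n + 1))
    (t : SimplexCategory.toTop.{u}.obj ⦋n⦌) :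
    simplexCoord (i.succAbove j) (SimplexCategory.toTop.{u}.map (SimplexCategory.δ i) t) =
      simplexCoord j t := by
  refine (FunOnFinite.linearMap_apply_apply ℝ ℝ _ t.down.1 _).trans
    ((Finset.sum_eq_single j ?_ ?_).trans rfl)
  · intro k hk hkj
    exact absurd (Fin.succAbove_right_injective (Finset.mem_filter.1 hk).2) hkj
  · intro hj
    exact (hj (Finset.mem_filter.2 ⟨Finset.mem_univ j, rfl⟩)).elim

theorem singularSimplex_zero_ext {X : TopCat.{u}} {σ τ : (TopCat.toSSet.obj X) _⦋0⦌}
    (h : singularMap σ (simplexVertex 0) = singularMap τ (simplexVertex 0)) : σ = τ := by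
  refine ULift.ext _ _ (TopCat.hom_ext (ContinuousMap.ext fun t => ?_))
  have ht : t = simplexVertex 0 :=
    Subsingleton.elim (α := SimplexCategory.toTop.{u}.obj ⦋0⦌) _ _
  rw [ht]
  exact h

theorem singularSimplex_δ {X : TopCat.{u}} {n : ℕ}
    (g : C(SimplexCategory.toTop.{u}.obj ⦋n + 1⦌, X)) (i : Fin (n + 2)) :
    (TopCat.toSSet.obj X).δ i (singularSimplex g) =
      singularSimplex (g.comp (SimplexCategory.toTop.{u}.map (SimplexCategory.δ i)).hom) :=
  rfl

/-- A path as a singular `1`-simplex. -/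
noncomputable def pathSimplex {X : TopCat.{u}} {x y : X} (p : Path x y) :
    (TopCat.toSSet.obj X) _⦋1⦌ :=
  singularSimplex (p.toContinuousMap.comp ⟨fun t => Set.projIcc 0 1 zero_le_one
    (simplexCoord 1 t), by fun_prop⟩)

theorem δ_zero_pathSimplex {X : TopCat.{u}} {x y : X} (p : Path x y) :
    (TopCat.toSSet.obj X).δ 0 (pathSimplex p) = singularSimplex (.const _ y) := by
  refine singularSimplex_zero_ext ?_
  change p (Set.projIcc 0 1 zero_le_one (simplexCoord 1
    (SimplexCategory.toTop.{u}.map (SimplexCategory.δ 0) (simplexVertex 0)))) = y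
  have h : simplexCoord 1 (SimplexCategory.toTop.{u}.map (SimplexCategory.δ 0)
      (simplexVertex (n := 0) 0)) = 1 :=
    (simplexCoord_δ_succAbove 0 0 _).trans (by simp [simplexCoord_vertex])
  rw [h, Set.projIcc_right]
  exact p.target

theorem δ_one_pathSimplex {X : TopCat.{u}} {x y : X} (p : Path x y) :
    (TopCat.toSSet.obj X).δ 1 (pathSimplex p) = singularSimplex (.const _ x) := by
  refine singularSimplex_zero_ext ?_
  change p (Set.projIcc 0 1 zero_le_one (simplexCoord 1
    (SimplexCategory.toTop.{u}.map (SimplexCategory.δ 1) (simplexVertex 0)))) = x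
  rw [simplexCoord_δ_self, Set.projIcc_left]
  exact p.source

/-- The map from the triangle to the square that is the identity on one edge and sends the other
edges into the three other sides. -/
noncomputable def triangleToSquare :
    C(SimplexCategory.toTop.{u}.obj ⦋2⦌, unitInterval × unitInterval) where
  toFun t := (Set.projIcc 0 1 zero_le_one (2 * simplexCoord 2 t),
    Set.projIcc 0 1 zero_le_one
      (simplexCoord 1 t + 2 * simplexCoord 2 t * (simplexCoord 1 t - simplexCoord 0 t)))

theorem exists_simplex_of_homotopic_refl {Y : TopCat.{u}} {y : Y} (p : Path y y)
    (h : p.Homotopic (Path.refl y)) : ∃ D : (TopCat.toSSet.obj Y) _⦋2⦌,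
      (TopCat.toSSet.obj Y).δ 0 D = singularSimplex (.const _ y) ∧
      (TopCat.toSSet.obj Y).δ 1 D = singularSimplex (.const _ y) ∧
      (TopCat.toSSet.obj Y).δ 2 D = pathSimplex p := by
  obtain ⟨H⟩ := h
  have h0 : ∀ a : ℝ, a ≤ 0 → Set.projIcc (0 : ℝ) 1 zero_le_one a = 0 := fun a ha =>
    Set.projIcc_of_le_left _ ha
  have h1 : ∀ a : ℝ, 1 ≤ a → Set.projIcc (0 : ℝ) 1 zero_le_one a = 1 := fun a ha =>
    Set.projIcc_of_right_le _ ha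
  have hH1 : ∀ s, H (1, s) = y := fun s => H.apply_one s
  -- Face 2 runs along time `0`, where `H` is `p`. Face 1 stays on the side with path parameter `0`.
  -- Face 0 follows parameter `1` and then time `1`. `H` is constant on these last three sides.
  refine ⟨singularSimplex (H.toContinuousMap.comp triangleToSquare), ?_, ?_, ?_⟩
  · rw [singularSimplex_δ]
    congr 1
    ext t
    have c0 := simplexCoord_δ_self 0 t
    have c1 := simplexCoord_δ_succAbove 0 0 t
    have c2 := simplexCoord_δ_succAbove 0 1 t
    have hs := sum_simplexCoord t
    have n0 := simplexCoord_nonneg 0 t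
    have n1 := simplexCoord_nonneg 1 t
    rw [Fin.sum_univ_two] at hs
    change simplexCoord 1 _ = _ at c1
    change simplexCoord 2 _ = _ at c2
    change H (Set.projIcc 0 1 zero_le_one (2 * simplexCoord 2 _),
      Set.projIcc 0 1 zero_le_one (simplexCoord 1 _ + 2 * simplexCoord 2 _ *
        (simplexCoord 1 _ - simplexCoord 0 _))) = y
    erw [c0, c1, c2]
    by_cases hh : 1 ≤ 2 * simplexCoord 1 t
    · rw [h1 _ hh, hH1]
    · rw [h1 (simplexCoord 0 t + _) (by nlinarith)]
      exact H.target _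
  · rw [singularSimplex_δ]
    congr 1
    ext t
    have c1 := simplexCoord_δ_self 1 t
    have c0 := simplexCoord_δ_succAbove 1 0 t
    have c2 := simplexCoord_δ_succAbove 1 1 t
    have n0 := simplexCoord_nonneg 0 t
    have n1 := simplexCoord_nonneg 1 t
    change simplexCoord 0 _ = _ at c0
    change simplexCoord 2 _ = _ at c2
    change H (Set.projIcc 0 1 zero_le_one (2 * simplexCoord 2 _),
      Set.projIcc 0 1 zero_le_one (simplexCoord 1 _ + 2 * simplexCoord 2 _ *
        (simplexCoord 1 _ - simplexCoord 0 _))) = y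
    erw [c0, c1, c2]
    rw [h0 (0 + _) (by nlinarith [mul_nonneg n0 n1])]
    exact H.source _
  · rw [singularSimplex_δ, pathSimplex]
    congr 1
    ext t
    have c2 := simplexCoord_δ_self 2 t
    have c1 := simplexCoord_δ_succAbove 2 1 t
    change simplexCoord 1 _ = _ at c1
    change H (Set.projIcc 0 1 zero_le_one (2 * simplexCoord 2 _),
      Set.projIcc 0 1 zero_le_one (simplexCoord 1 _ + 2 * simplexCoord 2 _ *
        (simplexCoord 1 _ - simplexCoord 0 _))) = p (Set.projIcc 0 1 zero_le_one
          (simplexCoord 1 t))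
    erw [c1, c2]
    rw [h0 (2 * 0) (by simp)]
    simp

end SingularSimplices

/-! ### Cocycles on edges of singular simplices -/

namespace CategoryCocycle

open CategoryTheory Simplicial

variable {X : Type u} [TopologicalSpace X] {E : Type w} [Group E]
  (F : CategoryCocycle (FundamentalGroupoid X) E)

/-- The value of a cocycle on the edge between two vertices of a singular simplex. -/
noncomputable def edge {n : ℕ} (σ : (TopCat.toSSet.obj (TopCat.of X)) _⦋n⦌) (i j : Fin (n + 1)) :
    E :=
  F.along (S := SimplexCategory.toTop.{u}.obj ⦋n⦌) (X := X) (singularMap σ) (simplexVertex i)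
    (simplexVertex j)

theorem edge_mul_edge {n : ℕ} (σ : (TopCat.toSSet.obj (TopCat.of X)) _⦋n⦌)
    (i j k : Fin (n + 1)) : F.edge σ j k * F.edge σ i j = F.edge σ i k :=
  F.along_mul_along _ _ _ _

theorem edge_δ {n : ℕ} (σ : (TopCat.toSSet.obj (TopCat.of X)) _⦋n + 1⦌) (k : Fin (n + 2))
    (i j : Fin (n + 1)) : F.edge ((TopCat.toSSet.obj (TopCat.of X)).δ k σ) i j =
      F.edge σ (k.succAbove i) (k.succAbove j) := by
  refine (F.along_comp (X := X) (singularMap σ)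
    (SimplexCategory.toTop.{u}.map (SimplexCategory.δ k)).hom _ _).trans ?_
  have h := toTop_map_simplexVertex.{u} (SimplexCategory.δ k)
  exact congrArg₂ (F.along (X := X) (singularMap σ)) (h i) (h j)

theorem edge_const {n : ℕ} (x : X) (i j : Fin (n + 1)) :
    F.edge (singularSimplex (X := TopCat.of X) (.const _ x)) i j = 1 :=
  F.along_const _ _ _

theorem edge_pathSimplex {x y : X} (p : Path x y) :
    F.edge (pathSimplex (X := TopCat.of X) p) 0 1 =
      F.toFun (x := .mk x) (y := .mk y) (Path.Homotopic.Quotient.mk p) := by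
  rw [F.toFun_mk]
  refine (F.along_comp (X := X) p.toContinuousMap _ _ _).trans ?_
  refine congrArg₂ (F.along p.toContinuousMap) ?_ ?_
  · simp [simplexCoord_vertex]
  · simp [simplexCoord_vertex]

theorem map_edge {Y : Type u} [TopologicalSpace Y] {B : Type w'} [Group B]
    (G : CategoryCocycle (FundamentalGroupoid Y) B) (ψ : C(X, Y)) (p : E →* B)
    (h : ∀ (y z : FundamentalGroupoid X) (q : y ⟶ z),
      p (F.toFun q) = G.toFun ((FundamentalGroupoid.map ψ).map q)) {n : ℕ}
    (σ : (TopCat.toSSet.obj (TopCat.of X)) _⦋n⦌) (i j : Fin (n + 1)) :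
    p (F.edge σ i j) = G.edge ((TopCat.toSSet.map (TopCat.ofHom ψ)).app _ σ) i j :=
  F.along_comp_left G ψ p h _ _ _

end CategoryCocycle

/-! ### The kernel on fundamental groups -/

section FundamentalGroupKernel

open CategoryTheory Simplicial

variable {X Y : Type u} [TopologicalSpace X] [TopologicalSpace Y]

theorem IsIntegralHomologyEquiv.isIso_homologyMap {ψ : C(X, Y)}
    (hψ : IsIntegralHomologyEquiv ψ) (n : ℕ) :
    IsIso (SSet.homologyMap (TopCat.toSSet.map (TopCat.ofHom ψ)) integers.{u} n) :=
  hψ n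

theorem IsIntegralHomologyEquiv.joined_of_joined {ψ : C(X, Y)} (hψ : IsIntegralHomologyEquiv ψ)
    {x x' : X} (h : Joined (ψ x) (ψ x')) : Joined x x' := by
  classical
  have := hψ.isIso_homologyMap 0
  have h := SSet.eq_of_homologyMap_zero_isIso (TopCat.toSSet.map (TopCat.ofHom ψ))
    -- The 0-cocycle is the indicator function of the path component of `x`.
    (fun σ => if Joined x (singularMap σ (simplexVertex 0)) then ULift.up.{u} (1 : ℤ) else 0)
    (fun σ => ?_)
    (x := singularSimplex (X := TopCat.of X) (.const _ x))
    (y := singularSimplex (X := TopCat.of X) (.const _ x'))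
    (pathSimplex (X := TopCat.of Y) h.somePath)
    (δ_one_pathSimplex (X := TopCat.of Y) _) (δ_zero_pathSimplex (X := TopCat.of Y) _)
  · have hx : Joined x (singularMap (singularSimplex (X := TopCat.of X) (n := 0) (.const _ x))
        (simplexVertex 0)) := Joined.refl x
    rw [if_pos hx] at h
    by_contra hne
    have hx' : ¬ Joined x (singularMap (singularSimplex (X := TopCat.of X) (n := 0)
        (.const _ x')) (simplexVertex 0)) := hne
    rw [if_neg hx'] at h
    exact one_ne_zero (congrArg ULift.down h)
  · have hj : ∀ s t, Joined (singularMap σ s) (singularMap σ t) := fun s t =>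
      ⟨(PathConnectedSpace.somePath s t).map (singularMap σ).continuous⟩
    refine if_congr ⟨fun h => h.trans (hj _ _), fun h => h.trans (hj _ _)⟩ rfl rfl

/-- If a homology equivalence induces an epimorphism on fundamental groups, the kernel of that
epimorphism is relatively perfect. -/
theorem IsIntegralHomologyEquiv.ker_map_le_commutator {ψ : C(X, Y)}
    (hψ : IsIntegralHomologyEquiv ψ) (x₀ : X)
    (hf : Function.Surjective (FundamentalGroup.map ψ x₀)) :
    (FundamentalGroup.map ψ x₀).ker ≤
      ⁅(FundamentalGroup.map ψ x₀).ker, (⊤ : Subgroup (FundamentalGroup X x₀))⁆ := by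
  set f := FundamentalGroup.map ψ x₀
  let N : Subgroup (FundamentalGroup X x₀) := ⁅f.ker, ⊤⁆
  have hN : N.Normal := inferInstance
  have hNk : N ≤ f.ker := Subgroup.commutator_le_left _ _
  let p : FundamentalGroup X x₀ ⧸ N →* FundamentalGroup Y (ψ x₀) := QuotientGroup.lift N f hNk
  have hp : Function.Surjective p := fun b => by
    obtain ⟨a, rfl⟩ := hf b
    exact ⟨QuotientGroup.mk a, rfl⟩
  have hc : p.ker ≤ Subgroup.center _ := ker_lift_commutator_le_center f hNk
  obtain ⟨M, _, k, m, hk, hk1, hm, hm1⟩ := exists_cocycle_of_central p hp hc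
  -- `G` extends the identity of `π₁ Y`, and `F` lifts its pull-back to the central extension. By
  -- injectivity on `H₀`, other path components of `X` miss the component of `ψ x₀`, so the
  -- pull-back is trivial there.
  obtain ⟨G, hG, hG1⟩ := CategoryCocycle.exists_extension (FundamentalGroupoid.mk (ψ x₀))
    (MonoidHom.id (FundamentalGroup Y (ψ x₀)))
  obtain ⟨F, hF, hFG⟩ := CategoryCocycle.exists_lift p hp (FundamentalGroupoid.mk x₀)
    (QuotientGroup.mk' N) ⟨fun q => G.toFun ((FundamentalGroupoid.map ψ).map q), fun q r => by
      rw [Functor.map_comp, G.toFun_comp]⟩ (fun q => (hG (f q)).symm)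
    (fun y z q h => hG1 _ _ _ ⟨fun a => by
      obtain ⟨b⟩ := hψ.joined_of_joined (x := x₀) (x' := y.as) ⟨Quotient.out a⟩
      exact h.false (Path.Homotopic.Quotient.mk b)⟩)
  have := hψ.isIso_homologyMap 1
  have := hψ.isIso_homologyMap 2
  intro γ hγ
  obtain ⟨c, rfl⟩ := Path.Homotopic.Quotient.mk_surjective γ
  have hnull : (c.map ψ.continuous).Homotopic (Path.refl (ψ x₀)) :=
    Path.Homotopic.Quotient.exact hγ
  obtain ⟨D, hD0, hD1, hD2⟩ := exists_simplex_of_homotopic_refl (Y := TopCat.of Y) _ hnull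
  have key := SSet.cochain_eq_of_homologyMap_isIso (TopCat.toSSet.map (TopCat.ofHom ψ))
    (fun σ => k (G.edge σ 1 2) (G.edge σ 0 1)) (fun σ => m (F.edge σ 0 1))
    (fun σ => ?_) (fun σ => ?_) (pathSimplex (X := TopCat.of X) c)
    ((δ_zero_pathSimplex _).trans (δ_one_pathSimplex _).symm) D (hD0.trans hD1.symm) hD2
  -- Two faces of `D` are constant, so all its edges have value `1` and the cocycle takes the value
  -- `k 1 1 = 0` on it.
  · have e1 : G.edge D 1 2 = 1 :=
      (G.edge_δ D 0 0 1).symm.trans ((congrArg (G.edge · 0 1) hD0).trans (G.edge_const _ _ _))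
    have e2 : G.edge D 0 2 = 1 :=
      (G.edge_δ D 1 0 1).symm.trans ((congrArg (G.edge · 0 1) hD1).trans (G.edge_const _ _ _))
    have e3 : G.edge D 0 1 = 1 := by
      rw [← e2, ← G.edge_mul_edge D 0 1 2, e1, one_mul]
    simp only [e1, e3, hk1] at key
    have hmk : F.edge (pathSimplex (X := TopCat.of X) c) 0 1 =
        QuotientGroup.mk' N (Path.Homotopic.Quotient.mk c) :=
      (F.edge_pathSimplex c).trans (hF _)
    rw [hmk] at key
    exact (QuotientGroup.eq_one_iff _).1 (hm1 _ hγ key)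
  -- On a 3-simplex the singular cocycle condition is the group cocycle identity at the edges 23, 12
  -- and 01.
  · simp only [G.edge_δ]
    have h1 := G.edge_mul_edge σ 0 1 2
    have h2 := G.edge_mul_edge σ 1 2 3
    have := hk (G.edge σ 2 3) (G.edge σ 1 2) (G.edge σ 0 1)
    rw [h1, h2] at this
    exact this
  · have h := hm (F.edge σ 1 2) (F.edge σ 0 1)
    rw [F.edge_mul_edge, F.map_edge G ψ p hFG, F.map_edge G ψ p hFG] at h
    simp only [F.edge_δ]
    exact h

end FundamentalGroupKernel

theorem proposition3p1 {X Y : Type u} [TopologicalSpace X] [TopologicalSpace Y]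
    (ψ : C(X, Y)) (hψ : IsIntegralHomologyEquiv ψ) (x₀ : X)
    (hf : Function.Surjective (FundamentalGroup.map ψ x₀)) (G : Type w) [Group G] :
    (localizationRadical (FundamentalGroup.map ψ x₀) hf).sub G ≤ relPerfectCore G :=
  localizationRadical_le_relPerfectCore _ hf (hψ.ker_map_le_commutator x₀ hf) G
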